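/- Let $0<b<a$ and $c=\sqrt{a^2-b^2}$. For $\lambda<b^2$ let $$\mathcal E_\lambda:\ \frac{x^2}{a^2-\lambda}+\frac{y^2}{b^2-\lambda}=1,\qquad X_{3,\lambda}=\left(0,-\frac{c\sqrt{4a^2-b^2-3\lambda}}{\sqrt{b^2-\lambda}}\right),\qquad R_\lambda=\frac{2(a^2-\lambda)}{\sqrt{b^2-\lambda}},$$ and let $\mathcal F_\lambda$ be the family of nondegenerate triangles, with vertices $P_0,P_1,P_2$ labelled counterclockwise (indices modulo $3$), that circumscribe $\mathcal E_\lambda$ (each sideline is tangent to $\mathcal E_\lambda$ at a point of the side) and are inscribed in the circle with center $X_{3,\lambda}$ and radius $R_\lambda$. The first Brocard point $\Omega_1$ of such a triangle is the point through which the three rays $P_iP_{i+1}$ pass when each is rotated about $P_i$ by one common angle towards the interior of the triangle; the second Brocard point $\Omega_2$ is defined in the same way with the rays $P_iP_{i-1}$. 1. For every $\lambda<b^2$ the foci of $\mathcal E_\lambda$ are $(\pm c,0)$, that is, $\mathcal E_\lambda$ is the set of points whose distances from $(-c,0)$ and $(c,0)$ add up to $2\sqrt{a^2-\lambda}$. 2.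 For every $\lambda<b^2$, every triangle of $\mathcal F_\lambda$ has its Brocard points at the foci: $\Omega_1=(-c,0)$ and $\Omega_2=(c,0)$. 3. For every $\lambda<b^2$, each point of the circle with center $X_{3,\lambda}$ and radius $R_\lambda$ is the vertex $P_0$ of exactly one triangle of $\mathcal F_\lambda$; so each $\mathcal F_\lambda$ is a (nonempty) one-parameter family. 4. As $\lambda$ ranges over $(-\infty,b^2)$, the families $\mathcal F_\lambda$ cover the entire two-parameter family of triangles with these Brocard points: every nondegenerate triangle, labelled counterclockwise, with $\Omega_1=(-c,0)$ and $\Omega_2=(c,0)$ belongs to $\mathcal F_\lambda$ for exactly one $\lambda<b^2$. 5. A nondegenerate triangle, labelled counterclockwise, has $\Omega_1=(c,0)$ and $\Omega_2=(-c,0)$ if and only if, for some $\lambda<b^2$, it circumscribes $\mathcal E_\lambda$ and is inscribed in the circle of radius $R_\lambda$ whose center is the reflection of $X_{3,\lambda}$ in the $x$-axis. -/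

import Mathlib

namespace BrocardPorism

/-! The Euclidean plane is `ℂ`: the point `(x, y)` is `x + y i`.  A triangle is given by its
vertices `P 0, P 1, P 2`; indices in `Fin 3` are cyclic, so `P (i + 1)` follows `P i`, and
`P (i + 2)` precedes it. -/

/-- `P` is a nondegenerate triangle with its vertices labelled counterclockwise
(positive signed area). Every nondegenerate triangle has such a labelling. -/
def IsCCWTriangle (P : Fin 3 → ℂ) : Prop :=
  0 < (P 1 - P 0).re * (P 2 - P 0).im - (P 1 - P 0).im * (P 2 - P 0).re

/-- `Ω` is the first Brocard point of the counterclockwise triangle `P`: for some angle `ω`, the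
rays from `P i` through `P (i + 1)`, rotated about `P i` by `ω` towards the interior
(that is, counterclockwise), all pass through `Ω`. -/
def IsFirstBrocardPoint (P : Fin 3 → ℂ) (Ω : ℂ) : Prop :=
  ∃ ω : ℝ, 0 < ω ∧ ω < Real.pi ∧ ∀ i : Fin 3, ∃ t : ℝ, 0 < t ∧
    Ω = P i + t * (Complex.exp (ω * Complex.I) * (P (i + 1) - P i))

/-- `Ω` is the second Brocard point of the counterclockwise triangle `P`: the triangle is now
traversed clockwise, and the rays from `P i` through `P (i + 2)`, rotated about `P i` by `ω`
towards the interior (that is, clockwise), all pass through `Ω`. -/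
def IsSecondBrocardPoint (P : Fin 3 → ℂ) (Ω : ℂ) : Prop :=
  ∃ ω : ℝ, 0 < ω ∧ ω < Real.pi ∧ ∀ i : Fin 3, ∃ t : ℝ, 0 < t ∧
    Ω = P i + t * (Complex.exp (-(ω * Complex.I)) * (P (i + 2) - P i))

/-- The triangle `P` is inscribed in the circle with centre `O` and radius `R`. -/
def IsInscribed (P : Fin 3 → ℂ) (O : ℂ) (R : ℝ) : Prop :=
  ∀ i, P i ∈ Metric.sphere O R

/-- The triangle `P` circumscribes the ellipse `E`: every sideline is tangent to `E` (a line is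
tangent to an ellipse when it meets it in exactly one point), touching it at a point of
the side. -/
def Circumscribes (P : Fin 3 → ℂ) (E : Set ℂ) : Prop :=
  ∀ i : Fin 3, ∃ T ∈ segment ℝ (P i) (P (i + 1)),
    (line[ℝ, P i, P (i + 1)] : Set ℂ) ∩ E = {T}

/-- The ellipse `x² / (a² - l) + y² / (b² - l) = 1` of the confocal family. -/
def confocalEllipse (a b l : ℝ) : Set ℂ :=
  {z | z.re ^ 2 / (a ^ 2 - l) + z.im ^ 2 / (b ^ 2 - l) = 1}

/-- Half the distance between the foci. -/
noncomputable def focalDist (a b : ℝ) : ℝ := √(a ^ 2 - b ^ 2)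

/-- The centre `(0, -c δ / √(b² - l))`, where `δ = √(4 a² - b² - 3 l)`. -/
noncomputable def circleCenter (a b l : ℝ) : ℂ :=
  ⟨0, -(focalDist a b * √(4 * a ^ 2 - b ^ 2 - 3 * l) / √(b ^ 2 - l))⟩

/-- The radius `2 (a² - l) / √(b² - l)`. -/
noncomputable def circleRadius (a b l : ℝ) : ℝ :=
  2 * (a ^ 2 - l) / √(b ^ 2 - l)

/-- The triangles, labelled counterclockwise, that circumscribe the confocal ellipse with
parameter `l` and are inscribed in the circle with centre `circleCenter a b l` and radius
`circleRadius a b l`. -/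
def brocardFamily (a b l : ℝ) : Set (Fin 3 → ℂ) :=
  {P | IsCCWTriangle P ∧ IsInscribed P (circleCenter a b l) (circleRadius a b l) ∧
    Circumscribes P (confocalEllipse a b l)}

/-- The same with the circle reflected in the `x`-axis, the major axis of the ellipses. -/
def reflectedBrocardFamily (a b l : ℝ) : Set (Fin 3 → ℂ) :=
  {P | IsCCWTriangle P ∧
    IsInscribed P (starRingEnd ℂ (circleCenter a b l)) (circleRadius a b l) ∧
    Circumscribes P (confocalEllipse a b l)}

end BrocardPorism

namespace BrocardPorism
open Complex ComplexConjugate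

/-! Let `S`, `C` be the sine and cosine of the Brocard angle, and scale the circumcircle to the unit
circle. The Brocard points then lie at `I * D * (C ± S * I)` with `D = √(1 - 4 S²)`. Rotating the
chord from `z` to `w` about `z` onto the first of them is a relation bilinear in `z` and `w`
(`link`), so `w` is a Möbius image of `z`. The matrix of this map satisfies `tr² = det`, which makes
its cube scalar: every point of the circle starts a closed triangle (`link_cycle`).

The discriminant of the ellipse along a chord factors into the links of its two directions
(`link_mul_link`). Hence a sideline is tangent exactly when its ends are linked one way or the other
(`tangent_iff_link`), and orientation selects the same direction on all three sides
(`scale_mem_brocardFamily_iff`). The families are therefore the linked triples, and their Brocard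
points can be read off.

Conversely, the rays of any triangle with a first Brocard point give a Möbius three-cycle. The
condition `tr² = det` fixes the distance of that point from the circumcentre, so the triangle is
similar to a linked triple (`IsCCWTriangle.exists_link`). The given Brocard points then determine
the similarity, and the circumcentre determines the parameter. -/

/-- `S` and `C` are the sine and cosine of an acute angle with `S ≤ 1 / 2`, and `D = √(1 - 4 S²)`. -/
structure IsBrocardAngle (S C D : ℝ) : Prop where
  sin_pos : 0 < S
  cos_pos : 0 < C
  nonneg : 0 ≤ D
  sq_add_sq : S ^ 2 + C ^ 2 = 1
  sq_eq : D ^ 2 = 1 - 4 * S ^ 2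

/-! ### The Möbius map of linked points on the unit circle. -/

/-- The bilinear form whose vanishing says that the chord from `z` to `w` of the unit circle,
rotated about `z` by the angle with sine `S` and cosine `C`, passes through
`I * D * (C + S * I)`. -/
noncomputable def link (S C D : ℝ) (z w : ℂ) : ℂ :=
  (C + S * I) * w + (C - S * I) * z + I * D * (z * w - 1)

theorem mul_conj_of_norm_eq_one {z : ℂ} (hz : ‖z‖ = 1) : z * conj z = 1 := by
  rw [mul_conj, normSq_eq_norm_sq, hz]; simp

section
variable {S C D : ℝ} {z w : ℂ}

namespace IsBrocardAngle

theorem lt_one (h : IsBrocardAngle S C D) : D < 1 := by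
  nlinarith [h.sin_pos, h.nonneg, h.sq_eq]

theorem lt_cos (h : IsBrocardAngle S C D) : D < C := by
  have := h.cos_pos
  nlinarith [h.nonneg, h.sq_eq, h.sq_add_sq, mul_pos h.sin_pos h.sin_pos]

theorem norm_rot (h : IsBrocardAngle S C D) : ‖(C : ℂ) + S * I‖ = 1 := by
  rw [norm_add_mul_I, add_comm, h.sq_add_sq, Real.sqrt_one]

theorem norm_rot_neg (h : IsBrocardAngle S C D) : ‖(C : ℂ) - S * I‖ = 1 := by
  have := norm_add_mul_I C (-S)
  rw [neg_sq, add_comm (C ^ 2), h.sq_add_sq, Real.sqrt_one] at this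
  rw [← this]; push_cast; ring_nf

/-- Denominators of the Möbius map and of its inverse: they cannot vanish on the unit circle because
`D < 1`. -/
theorem rot_add_ne_zero (h : IsBrocardAngle S C D) {u : ℂ} (hu : ‖u‖ = 1) (hz : ‖z‖ = 1) :
    u + I * D * z ≠ 0 := by
  intro h0
  have h1 : u = -(I * D * z) := by linear_combination h0
  have h2 : ‖u‖ = D := by
    rw [h1, norm_neg, norm_mul, norm_mul, hz, norm_I, norm_real, Real.norm_of_nonneg h.nonneg]
    ring
  linarith [h.lt_one]

end IsBrocardAngle

theorem link_right_injective (h : IsBrocardAngle S C D) (hz : ‖z‖ = 1) {w' : ℂ}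
    (h1 : link S C D z w = 0) (h2 : link S C D z w' = 0) : w = w' := by
  have h3 := h.rot_add_ne_zero h.norm_rot hz
  apply mul_left_cancel₀ h3
  simp only [link] at h1 h2
  linear_combination h1 - h2

theorem link_left_injective (h : IsBrocardAngle S C D) (hw : ‖w‖ = 1) {z' : ℂ}
    (h1 : link S C D z w = 0) (h2 : link S C D z' w = 0) : z = z' := by
  have h3 := h.rot_add_ne_zero h.norm_rot_neg hw
  apply mul_left_cancel₀ h3
  simp only [link] at h1 h2
  linear_combination h1 - h2

theorem exists_link (h : IsBrocardAngle S C D) (hz : ‖z‖ = 1) :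
    ∃ w : ℂ, ‖w‖ = 1 ∧ link S C D z w = 0 := by
  have h3 := h.rot_add_ne_zero h.norm_rot hz
  have hzz := mul_conj_of_norm_eq_one hz
  refine ⟨(I * D - (C - S * I) * z) / (C + S * I + I * D * z), ?_, ?_⟩
  · rw [norm_div, div_eq_one_iff_eq (norm_ne_zero_iff.2 h3)]
    -- On the unit circle the numerator is `-z` times the conjugate of the denominator, so the
    -- circle is mapped to itself.
    have : I * D - (C - S * I) * z = -z * conj (C + S * I + I * D * z) := by
      simp only [map_add, map_mul, conj_I, conj_ofReal]
      linear_combination (-(I * D)) * hzz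
    rw [this, norm_mul, norm_neg, hz, norm_conj, one_mul]
  · simp only [link]
    field_simp
    ring

/-- The matrix of the map has trace `2 S I` and determinant `D² - 1 = -4 S²`, so `tr² = det`; by
Cayley–Hamilton its cube is scalar. The proof checks this by clearing both denominators. -/
theorem link_cycle (h : IsBrocardAngle S C D) {z₀ z₁ z₂ : ℂ} (h₀ : ‖z₀‖ = 1) (h₁ : ‖z₁‖ = 1)
    (h01 : link S C D z₀ z₁ = 0) (h12 : link S C D z₁ z₂ = 0) : link S C D z₂ z₀ = 0 := by
  have n0 := h.rot_add_ne_zero h.norm_rot h₀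
  have n1 := h.rot_add_ne_zero h.norm_rot h₁
  have hD : (D : ℂ) ^ 2 = 1 - 4 * S ^ 2 := by exact_mod_cast h.sq_eq
  have hC : (C : ℂ) ^ 2 = 1 - S ^ 2 := by
    have : ((S : ℂ) ^ 2 + C ^ 2) = 1 := by exact_mod_cast h.sq_add_sq
    linear_combination this
  apply mul_left_cancel₀ (mul_ne_zero n0 n1)
  simp only [link] at *
  rw [mul_zero]
  have e1 : (C + S * I + I * D * z₀) * z₁ = I * D - (C - S * I) * z₀ := by
    linear_combination h01
  have e2 : (C + S * I + I * D * z₁) * z₂ = I * D - (C - S * I) * z₁ := by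
    linear_combination h12
  generalize hX : (C + S * I + I * D * z₀ : ℂ) = X at *
  have e3 : (C + S * I + I * D * z₀ : ℂ) * (C + S * I + I * D * z₁)
      = (C + S * I) * (C + S * I + I * D * z₀) + I * D * (I * D - (C - S * I) * z₀) := by
    rw [hX]; linear_combination I * D * e1
  have e4 : X * (I * D - (C - S * I) * z₁) = I * D * (C + S * I + I * D * z₀) -
      (C - S * I) * (I * D - (C - S * I) * z₀) := by
    rw [hX]; linear_combination (-(C - S * I)) * e1
  rw [hX] at e3
  have e5 : X * (C + S * I + I * D * z₁) * z₂ = X * (I * D - (C - S * I) * z₁) := by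
    linear_combination X * e2
  rw [e4] at e5
  have : X * (C + S * I + I * D * z₁) *
      ((C + S * I) * z₀ + (C - S * I) * z₂ + I * D * (z₂ * z₀ - 1)) =
      (X * (C + S * I + I * D * z₁)) * ((C + S * I) * z₀ - I * D) +
      (X * (C + S * I + I * D * z₁) * z₂) * ((C - S * I) + I * D * z₀) := by ring
  rw [this, e5, e3]
  rw [← hX]
  have hI3 : I ^ 3 = -I := by rw [pow_succ, I_sq]; ring
  have hC3 : (C : ℂ) ^ 3 = C * (1 - S ^ 2) := by rw [← hC]; ring
  have hD3 : (D : ℂ) ^ 3 = D * (1 - 4 * S ^ 2) := by rw [← hD]; ring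
  ring_nf
  simp only [I_sq, hI3, hC3, hD3, hC, hD]
  ring_nf

/-- The common denominator of the rotated-ray parameters. -/
theorem link_self_factor_pos (h : IsBrocardAngle S C D) (hz : ‖z‖ = 1) :
    0 < 2 * C - 2 * D * z.im := by
  have := (abs_le.1 (abs_im_le_norm z)).2
  rw [hz] at this
  nlinarith [h.lt_cos, h.nonneg]

theorem link_first (h : IsBrocardAngle S C D) (hz : ‖z‖ = 1) (hl : link S C D z w = 0) :
    ∃ t : ℝ, 0 < t ∧ I * D * (C + S * I) - z = t * ((C + S * I) * (w - z)) := by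
  have hd := link_self_factor_pos h hz
  have n0 := h.rot_add_ne_zero h.norm_rot hz
  have hn : 0 < 1 + D ^ 2 - 2 * D * ((C - S * I) * z).im := by
    have := (abs_le.1 (abs_im_le_norm ((C - S * I) * z))).2
    rw [norm_mul, hz, h.norm_rot_neg] at this
    nlinarith [h.lt_one, h.nonneg]
  -- The numerator is the squared distance from `z` to the Brocard point; the denominator is `link S
  -- C D z z / z`.
  refine ⟨(1 + D ^ 2 - 2 * D * ((C - S * I) * z).im) / (2 * C - 2 * D * z.im),
    div_pos hn hd, ?_⟩
  have hd' : ((2 * C - 2 * D * z.im : ℝ) : ℂ) ≠ 0 := by exact_mod_cast hd.ne'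
  have hzz := mul_conj_of_norm_eq_one hz
  have hD : (D : ℂ) ^ 2 = 1 - 4 * S ^ 2 := by exact_mod_cast h.sq_eq
  have hC : (C : ℂ) ^ 2 = 1 - S ^ 2 := by
    have : ((S : ℂ) ^ 2 + C ^ 2) = 1 := by exact_mod_cast h.sq_add_sq
    linear_combination this
  have i1 : ((2 * C - 2 * D * z.im : ℝ) : ℂ) * z = 2 * C * z + I * D * (z ^ 2 - 1) := by
    have : ((z.im : ℝ) : ℂ) = (z - conj z) / (2 * I) := im_eq_sub_conj z
    push_cast
    rw [this]
    field_simp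
    linear_combination (D : ℂ) * hzz + D * (1 - z ^ 2) * I_sq
  have i2 : ((1 + D ^ 2 - 2 * D * ((C - S * I) * z).im : ℝ) : ℂ) * z
      = (1 + D ^ 2) * z + I * D * ((C - S * I) * z ^ 2 - (C + S * I)) := by
    have : ((((C - S * I) * z).im : ℝ) : ℂ) = ((C - S * I) * z - (C + S * I) * conj z) / (2 * I) := by
      rw [im_eq_sub_conj]; simp
    push_cast
    rw [this]
    field_simp
    linear_combination (D : ℂ) * (C + S * I) * hzz + D * (C + S * I - z ^ 2 * (C - S * I)) * I_sq
  have hz0 : z ≠ 0 := by rintro rfl; simp at hz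
  rw [ofReal_div, div_mul_eq_mul_div, eq_div_iff hd']
  apply mul_left_cancel₀ (mul_ne_zero n0 hz0)
  have e1 : (C + S * I + I * D * z) * w = I * D - (C - S * I) * z := by
    simp only [link] at hl; linear_combination hl
  have hI3 : I ^ 3 = -I := by rw [pow_succ, I_sq]; ring
  have hI4 : I ^ 4 = 1 := by rw [pow_succ, hI3]; linear_combination -I_sq
  have hC3 : (C : ℂ) ^ 3 = C * (1 - S ^ 2) := by rw [← hC]; ring
  have hD3 : (D : ℂ) ^ 3 = D * (1 - 4 * S ^ 2) := by rw [← hD]; ring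
  calc _ = (I * D * (C + S * I) - z) * (C + S * I + I * D * z) *
        (((2 * C - 2 * D * z.im : ℝ) : ℂ) * z) := by ring
    _ = (((1 + D ^ 2 - 2 * D * ((C - S * I) * z).im : ℝ) : ℂ) * z) * (C + S * I) *
        ((C + S * I + I * D * z) * w - (C + S * I + I * D * z) * z) := by
      rw [i1, i2, e1]
      ring_nf
      simp only [I_sq, hI3, hI4, hC3, hD3, hC, hD]
      ring_nf
    _ = _ := by ring

/-- Reflection in the imaginary axis reverses the direction of a link and interchanges the two
Brocard points, so `link_second` follows from `link_first`. -/
theorem link_reflect : link S C D (-conj w) (-conj z) = -conj (link S C D z w) := by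
  simp only [link, map_add, map_sub, map_mul, conj_I, conj_ofReal, map_one]
  ring

theorem link_second (h : IsBrocardAngle S C D) (hw : ‖w‖ = 1) (hl : link S C D z w = 0) :
    ∃ t : ℝ, 0 < t ∧ I * D * (C - S * I) - w = t * ((C - S * I) * (z - w)) := by
  obtain ⟨t, ht, e⟩ := link_first (z := -conj w) (w := -conj z) h (by simpa using hw)
    (by rw [link_reflect, hl]; simp)
  refine ⟨t, ht, ?_⟩
  have := congrArg (fun x => -conj x) e
  simp only [map_add, map_sub, map_mul, map_neg, conj_I, conj_ofReal, conj_conj] at this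
  linear_combination this

/-- A point linked to itself would be the Brocard point, which has modulus `D < 1`. -/
theorem ne_of_link (h : IsBrocardAngle S C D) (hz : ‖z‖ = 1) (hl : link S C D z w = 0) :
    z ≠ w := by
  rintro rfl
  obtain ⟨t, -, e⟩ := link_first h hz hl
  have h1 : z = I * D * (C + S * I) := by linear_combination -e
  have : ‖z‖ = D := by
    rw [h1, norm_mul, norm_mul, h.norm_rot, norm_I, norm_real, Real.norm_of_nonneg h.nonneg]
    ring
  linarith [h.lt_one]

end

/-! ### Normalised ellipse and circle; tangency of sidelines. -/

/-- The confocal ellipse with parameter `l` has semiaxes `R S` and `2 R S²`: it is the Brocard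
inellipse of the triangles with Brocard angle `(S, C)` and circumradius `R`. -/
structure IsBrocardScale (a b l S C D R : ℝ) : Prop extends IsBrocardAngle S C D where
  pos : 0 < D
  radius_pos : 0 < R
  major : a ^ 2 - l = R ^ 2 * S ^ 2
  minor : b ^ 2 - l = 4 * R ^ 2 * S ^ 4

section
variable {a b l S C D R : ℝ} {z w : ℂ}

theorem IsBrocardScale.focalDist_eq (h : IsBrocardScale a b l S C D R) :
    focalDist a b = R * S * D := by
  have := h.pos; have := h.radius_pos; have := h.sin_pos
  rw [focalDist, show a ^ 2 - b ^ 2 = (R * S * D) ^ 2 by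
    linear_combination h.major - h.minor - R ^ 2 * S ^ 2 * h.sq_eq, Real.sqrt_sq (by positivity)]

theorem IsBrocardScale.sqrt_minor (h : IsBrocardScale a b l S C D R) :
    √(b ^ 2 - l) = 2 * R * S ^ 2 := by
  have := h.radius_pos; have := h.sin_pos
  rw [h.minor, show 4 * R ^ 2 * S ^ 4 = (2 * R * S ^ 2) ^ 2 by ring, Real.sqrt_sq (by positivity)]

theorem IsBrocardScale.circleRadius_eq (h : IsBrocardScale a b l S C D R) :
    circleRadius a b l = R := by
  have := h.radius_pos; have := h.sin_pos
  rw [circleRadius, h.sqrt_minor, h.major]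
  field_simp

theorem IsBrocardScale.circleCenter_eq (h : IsBrocardScale a b l S C D R) :
    circleCenter a b l = -((R * C * D : ℝ) : ℂ) * I := by
  have := h.radius_pos; have := h.sin_pos; have := h.cos_pos
  have h1 : √(4 * a ^ 2 - b ^ 2 - 3 * l) = 2 * R * S * C := by
    rw [show 4 * a ^ 2 - b ^ 2 - 3 * l = (2 * R * S * C) ^ 2 by
      linear_combination 4 * h.major - h.minor - 4 * R ^ 2 * S ^ 2 * h.sq_add_sq,
      Real.sqrt_sq (by positivity)]
  rw [circleCenter, h1, h.sqrt_minor, h.focalDist_eq]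
  apply Complex.ext
  · simp
  · simp
    field_simp

theorem exists_isBrocardScale (hb : 0 < b) (hab : b < a) (hl : l < b ^ 2) :
    ∃ S C D R, IsBrocardScale a b l S C D R := by
  have hB : 0 < b ^ 2 - l := by linarith
  have hAB : b ^ 2 < a ^ 2 := by nlinarith
  have hA : 0 < a ^ 2 - l := by linarith
  obtain ⟨α, hα, eα⟩ : ∃ α, 0 < α ∧ α ^ 2 = a ^ 2 - l :=
    ⟨_, Real.sqrt_pos.2 hA, Real.sq_sqrt hA.le⟩
  obtain ⟨β, hβ, eβ⟩ : ∃ β, 0 < β ∧ β ^ 2 = b ^ 2 - l :=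
    ⟨_, Real.sqrt_pos.2 hB, Real.sq_sqrt hB.le⟩
  have hαβ : β ^ 2 < α ^ 2 := by linarith
  have e : 4 * (β / (2 * α)) ^ 2 = β ^ 2 / α ^ 2 := by field_simp; norm_num
  have hlt : β ^ 2 / α ^ 2 < 1 := by rw [div_lt_one (by positivity)]; exact hαβ
  have hS : (β / (2 * α)) ^ 2 < 1 / 4 := by linarith
  -- Solving `α = R S` and `β = 2 R S²` for the semiaxes `α`, `β` gives `S` and `R`.
  refine ⟨β / (2 * α), √(1 - (β / (2 * α)) ^ 2), √(1 - 4 * (β / (2 * α)) ^ 2),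
    2 * α ^ 2 / β, ⟨by positivity, Real.sqrt_pos.2 (by linarith), Real.sqrt_nonneg _, ?_, ?_⟩,
    Real.sqrt_pos.2 (by linarith), by positivity, ?_, ?_⟩
  · rw [Real.sq_sqrt (by linarith)]; ring
  · rw [Real.sq_sqrt (by linarith)]
  · rw [← eα]; field_simp
  · rw [← eβ]; field_simp; norm_num

theorem mem_confocalEllipse_iff (h : IsBrocardScale a b l S C D R) (ζ : ℂ) :
    circleCenter a b l + R * ζ ∈ confocalEllipse a b l ↔
      4 * S ^ 2 * ζ.re ^ 2 + (ζ.im - C * D) ^ 2 = 4 * S ^ 4 := by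
  have := h.radius_pos; have := h.sin_pos
  rw [confocalEllipse, Set.mem_ofPred_eq, h.circleCenter_eq, h.major, h.minor]
  simp only [add_re, add_im, mul_re, mul_im, neg_re, neg_im, ofReal_re, ofReal_im, I_re, I_im]
  rw [div_add_div _ _ (by positivity) (by positivity), div_eq_one_iff_eq (by positivity)]
  have hk : R ^ 4 * S ^ 2 ≠ 0 := by positivity
  constructor
  · intro e
    apply mul_left_cancel₀ hk
    linear_combination e
  · intro e
    linear_combination (R ^ 4 * S ^ 2) * e

/-- The discriminant of the ellipse along a chord factors into the two links of the chord. -/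
theorem link_mul_link (h : IsBrocardAngle S C D) (hz : ‖z‖ = 1) (hw : ‖w‖ = 1) :
    (w - z) ^ 2 * (link S C D z w * link S C D w z) = 4 * (z * w) ^ 2 *
      ((S ^ 2 * (4 * S ^ 2 * (w - z).re ^ 2 + (w - z).im ^ 2) -
        (z.re * (w - z).im - (z.im - C * D) * (w - z).re) ^ 2 : ℝ) : ℂ) := by
  have hzz := mul_conj_of_norm_eq_one hz
  have hww := mul_conj_of_norm_eq_one hw
  have hD : (D : ℂ) ^ 2 = 1 - 4 * S ^ 2 := by exact_mod_cast h.sq_eq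
  have hC : (C : ℂ) ^ 2 = 1 - S ^ 2 := by
    have : ((S : ℂ) ^ 2 + C ^ 2) = 1 := by exact_mod_cast h.sq_add_sq
    linear_combination this
  -- Since `conj z = 1 / z` on the unit circle, real and imaginary parts become polynomials after
  -- multiplication by `2 z w`.
  have dx : 2 * (z * w) * ((w - z).re : ℂ) = (w - z) * (z * w - 1) := by
    rw [re_eq_add_conj, map_sub]
    linear_combination z * hww - w * hzz
  have dy : 2 * (z * w) * ((w - z).im : ℂ) = -I * ((w - z) * (z * w + 1)) := by
    rw [im_eq_sub_conj, map_sub]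
    field_simp
    linear_combination -z * hww + w * hzz + (w - z) * (z * w + 1) * I_sq
  have cr : 2 * (z * w) * ((z.re * (w - z).im - z.im * (w - z).re : ℝ) : ℂ) =
      -I * ((w - z) * (w + z)) := by
    push_cast
    rw [re_eq_add_conj, im_eq_sub_conj, re_eq_add_conj, im_eq_sub_conj, map_sub]
    field_simp
    linear_combination 2 * w ^ 2 * hzz - 2 * z ^ 2 * hww + 2 * (w ^ 2 - z ^ 2) * I_sq
  have e1 : 2 * (z * w) *
      ((z.re * (w - z).im - (z.im - C * D) * (w - z).re : ℝ) : ℂ) =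
      -I * ((w - z) * (w + z)) + C * D * ((w - z) * (z * w - 1)) := by
    rw [← cr, ← dx]; push_cast; ring
  have e2 : 4 * (z * w) ^ 2 *
      ((S ^ 2 * (4 * S ^ 2 * (w - z).re ^ 2 + (w - z).im ^ 2) -
        (z.re * (w - z).im - (z.im - C * D) * (w - z).re) ^ 2 : ℝ) : ℂ) =
      S ^ 2 * (4 * S ^ 2 * (2 * (z * w) * ((w - z).re : ℂ)) ^ 2 +
        (2 * (z * w) * ((w - z).im : ℂ)) ^ 2) - (2 * (z * w) *
      ((z.re * (w - z).im - (z.im - C * D) * (w - z).re : ℝ) : ℂ)) ^ 2 := by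
    push_cast; ring
  rw [e2, e1, dx, dy]
  simp only [link]
  ring_nf
  simp only [I_sq, hC, hD]
  ring_nf

theorem discrim_eq_zero_of_unique_root {A B K t₀ : ℝ} (hA : 0 < A)
    (h0 : A * t₀ ^ 2 + B * t₀ + K = 0)
    (hu : ∀ t, A * t ^ 2 + B * t + K = 0 → t = t₀) : B ^ 2 = 4 * A * K := by
  -- The second root, by Vieta.
  have h1 := hu (-B / A - t₀) (by
    field_simp
    linear_combination A * h0)
  have h2 : B = -2 * A * t₀ := by
    field_simp at h1
    linarith
  rw [h2] at h0 ⊢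
  linear_combination -4 * A * h0

/-- A sideline of a triangle inscribed in the circle is tangent to the ellipse, at a point of the
side, exactly when its end points are linked. -/
theorem tangent_iff_link (h : IsBrocardScale a b l S C D R) (hz : ‖z‖ = 1) (hw : ‖w‖ = 1)
    (hzw : z ≠ w) :
    (∃ T ∈ segment ℝ (circleCenter a b l + R * z) (circleCenter a b l + R * w),
      (line[ℝ, circleCenter a b l + R * z, circleCenter a b l + R * w] : Set ℂ) ∩
        confocalEllipse a b l = {T}) ↔ link S C D z w = 0 ∨ link S C D w z = 0 := by
  have hS := h.sin_pos
  have hR := h.radius_pos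
  set O := circleCenter a b l with hO
  set A := 4 * S ^ 2 * (w - z).re ^ 2 + (w - z).im ^ 2 with hA
  set B := 2 * (4 * S ^ 2 * z.re * (w - z).re + (z.im - C * D) * (w - z).im) with hB
  set K := 4 * S ^ 2 * z.re ^ 2 + (z.im - C * D) ^ 2 - 4 * S ^ 4 with hK
  have hApos : 0 < A := by
    have : w - z ≠ 0 := sub_ne_zero.2 hzw.symm
    by_contra hcon
    have h1 : 0 ≤ 4 * S ^ 2 * (w - z).re ^ 2 := by positivity
    have h2 := sq_nonneg (w - z).im
    have h3 : (w - z).im = 0 := by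
      apply pow_eq_zero_iff (two_ne_zero) |>.1; linarith
    have h4 : 4 * S ^ 2 * (w - z).re ^ 2 = 0 := by linarith
    have h5 : (w - z).re = 0 := by
      have : 4 * S ^ 2 ≠ 0 := by positivity
      simpa [this, hS.ne'] using h4
    exact this (Complex.ext h5 h3)
  have hline (t : ℝ) : AffineMap.lineMap (O + R * z) (O + R * w) t =
      O + R * (z + t * (w - z)) := by
    rw [AffineMap.lineMap_apply]; simp only [vsub_eq_sub, real_smul, vadd_eq_add]; ring
  have hmem (t : ℝ) : O + R * (z + t * (w - z)) ∈ confocalEllipse a b l ↔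
      A * t ^ 2 + B * t + K = 0 := by
    rw [hO, mem_confocalEllipse_iff h]
    simp only [add_re, add_im, mul_re, mul_im, ofReal_re, ofReal_im]
    rw [← sub_eq_zero, hA, hB, hK]
    ring_nf
  have hinj (t t' : ℝ) (e : O + R * (z + t * (w - z)) = O + R * (z + t' * (w - z))) :
      t = t' := by
    have h1 : (R : ℂ) ≠ 0 := by exact_mod_cast hR.ne'
    have h2 : w - z ≠ 0 := sub_ne_zero.2 hzw.symm
    have h3 : (R : ℂ) * (w - z) * (t : ℂ) = R * (w - z) * t' := by linear_combination e
    exact_mod_cast mul_left_cancel₀ (mul_ne_zero h1 h2) h3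
  have hdisc : (B ^ 2 = 4 * A * K) ↔ link S C D z w = 0 ∨ link S C D w z = 0 := by
    rw [← mul_eq_zero]
    have key := link_mul_link h.toIsBrocardAngle hz hw
    have hd : B ^ 2 - 4 * A * K =
        16 * S ^ 2 * (S ^ 2 * (4 * S ^ 2 * (w - z).re ^ 2 + (w - z).im ^ 2) -
        (z.re * (w - z).im - (z.im - C * D) * (w - z).re) ^ 2) := by
      rw [hA, hB, hK]; ring
    have hzw0 : 4 * (z * w) ^ 2 ≠ 0 := by
      have h1 : z ≠ 0 := by rintro rfl; simp at hz
      have h2 : w ≠ 0 := by rintro rfl; simp at hw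
      exact mul_ne_zero (by norm_num) (pow_ne_zero _ (mul_ne_zero h1 h2))
    have h2 : (w - z) ^ 2 ≠ 0 := pow_ne_zero _ (sub_ne_zero.2 hzw.symm)
    rw [← sub_eq_zero, hd, mul_eq_zero, or_iff_right (by positivity : 16 * S ^ 2 ≠ 0)]
    rw [← mul_eq_zero_iff_left h2, key, mul_eq_zero, or_iff_right hzw0, ofReal_eq_zero]
  rw [← hdisc]
  constructor
  · rintro ⟨T, -, hT⟩
    have hTm : T ∈ ({T} : Set ℂ) := rfl
    rw [← hT] at hTm
    obtain ⟨hTl, hTe⟩ := hTm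
    obtain ⟨t₀, rfl⟩ := mem_affineSpan_pair_iff_exists_lineMap_eq.1 hTl
    rw [hline] at hTe hT
    refine discrim_eq_zero_of_unique_root hApos ((hmem _).1 hTe) fun t ht => hinj _ _ ?_
    have : O + R * (z + t * (w - z)) ∈ ({O + R * (z + t₀ * (w - z))} : Set ℂ) := by
      rw [← hT]
      refine ⟨?_, (hmem t).2 ht⟩
      rw [← hline]
      exact AffineMap.lineMap_mem_affineSpan_pair _ _ _
    exact this
  · intro hd
    have hroot (t : ℝ) : A * t ^ 2 + B * t + K = 0 ↔ t = -B / (2 * A) := by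
      have : 4 * A * (A * t ^ 2 + B * t + K) = (2 * A * t + B) ^ 2 := by
        linear_combination -hd
      rw [← mul_eq_zero_iff_left (by positivity : 4 * A ≠ 0), this, sq_eq_zero_iff,
        eq_div_iff (by positivity)]
      constructor <;> intro <;> linarith
    set t₀ := -B / (2 * A) with ht₀
    have hm := (hmem t₀).2 ((hroot t₀).2 rfl)
    refine ⟨O + R * (z + t₀ * (w - z)), ?_, ?_⟩
    · rw [hO, mem_confocalEllipse_iff h] at hm
      have hin : (z + t₀ * (w - z)).re ^ 2 + (z + t₀ * (w - z)).im ^ 2 ≤ 1 := by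
        have hS2 := h.sq_add_sq
        have hD2 := h.sq_eq
        generalize (z + t₀ * (w - z)).re = x at *
        generalize (z + t₀ * (w - z)).im = y at *
        -- On the ellipse, `1 - x² - y²` is a nonnegative multiple of a square, so the ellipse lies
        -- in the closed unit disc.
        have : 4 * S ^ 2 * (1 - x ^ 2 - y ^ 2) = (4 * S ^ 2 * C - (y - C * D) * D) ^ 2 := by
          linear_combination -hm - ((y - C * D) ^ 2 + 4 * S ^ 2 * C ^ 2) * hD2 - 4 * S ^ 2 * hS2
        have h2 : 0 ≤ 4 * S ^ 2 * (1 - x ^ 2 - y ^ 2) := by rw [this]; positivity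
        have := nonneg_of_mul_nonneg_right h2 (by positivity)
        linarith
      have hz2 : z.re ^ 2 + z.im ^ 2 = 1 := by
        have := Complex.sq_norm z; rw [hz, normSq_apply] at this; linarith
      have hw2 : w.re ^ 2 + w.im ^ 2 = 1 := by
        have := Complex.sq_norm w; rw [hw, normSq_apply] at this; linarith
      have hdpos : 0 < (w - z).re ^ 2 + (w - z).im ^ 2 := by
        have := normSq_pos.2 (sub_ne_zero.2 hzw.symm)
        rw [normSq_apply] at this; linarith
      -- On the chord, `1 - |z + t (w - z)|² = t (1 - t) |w - z|²`; a point in the disc therefore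
      -- lies on the side.
      have hpos : 0 ≤ t₀ * (1 - t₀) := by
        simp only [add_re, add_im, mul_re, mul_im, ofReal_re, ofReal_im, sub_re, sub_im] at hin hdpos
        refine nonneg_of_mul_nonneg_left ?_ hdpos
        rw [← sub_nonneg] at hin
        refine hin.trans_eq ?_
        linear_combination (t₀ - 1) * hz2 - t₀ * hw2
      have h01 : 0 ≤ t₀ ∧ t₀ ≤ 1 := ⟨by nlinarith, by nlinarith⟩
      rw [segment_eq_image_lineMap]
      exact ⟨t₀, h01, hline t₀⟩
    · ext T
      constructor
      · rintro ⟨hTl, hTe⟩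
        obtain ⟨t, rfl⟩ := mem_affineSpan_pair_iff_exists_lineMap_eq.1 hTl
        rw [hline] at hTe ⊢
        rw [(hroot t).1 ((hmem t).1 hTe)]
        rfl
      · rintro rfl
        refine ⟨?_, hm⟩
        rw [← hline]
        exact AffineMap.lineMap_mem_affineSpan_pair _ _ _

end

/-! ### Orientation, and the families as linked triples. -/

theorem cross_pos_of_ray {S C t : ℝ} (hS : 0 < S) (ht : 0 < t) {p z w : ℂ} (hzw : z ≠ w)
    (e : p - z = t * ((C + S * I) * (w - z))) :
    0 < (w - z).re * (p - z).im - (w - z).im * (p - z).re := by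
  have h1 := normSq_pos.2 (sub_ne_zero.2 hzw.symm)
  rw [normSq_apply] at h1
  have h2 := congrArg re e
  have h3 := congrArg im e
  simp only [mul_re, mul_im, add_re, add_im, ofReal_re, ofReal_im, I_re, I_im] at h2 h3
  rw [h2, h3]
  have : 0 < t * S * ((w - z).re * (w - z).re + (w - z).im * (w - z).im) := by positivity
  linarith

section
variable {a b l S C D R : ℝ}

/-- The Brocard point lies to the left of each directed side, and the signed areas it spans with the
three sides add up to that of the triangle. -/
theorem area_pos_of_link (h : IsBrocardAngle S C D) {x y v : ℂ} (hx : ‖x‖ = 1) (hy : ‖y‖ = 1)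
    (hv : ‖v‖ = 1) (hxy : link S C D x y = 0) (hyv : link S C D y v = 0)
    (hvx : link S C D v x = 0) :
    0 < (y - x).re * (v - x).im - (y - x).im * (v - x).re := by
  obtain ⟨t, ht, et⟩ := link_first h hx hxy
  obtain ⟨s, hs, es⟩ := link_first h hy hyv
  obtain ⟨r, hr, er⟩ := link_first h hv hvx
  have h1 := cross_pos_of_ray h.sin_pos ht (ne_of_link h hx hxy) et
  have h2 := cross_pos_of_ray h.sin_pos hs (ne_of_link h hy hyv) es
  have h3 := cross_pos_of_ray h.sin_pos hr (ne_of_link h hv hvx) er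
  simp only [sub_re, sub_im] at *
  linarith

theorem isCCWTriangle_scale_iff (O : ℂ) (hR : 0 < R) (z : Fin 3 → ℂ) :
    IsCCWTriangle (fun i => O + R * z i) ↔ IsCCWTriangle z := by
  have hR2 : 0 < R ^ 2 := by positivity
  rw [IsCCWTriangle, IsCCWTriangle, ← mul_pos_iff_of_pos_left hR2
    (b := (z 1 - z 0).re * (z 2 - z 0).im - (z 1 - z 0).im * (z 2 - z 0).re)]
  simp only [sub_re, sub_im, add_re, add_im, mul_re, mul_im, ofReal_re, ofReal_im]
  ring_nf

theorem IsCCWTriangle.pairwise_ne {z : Fin 3 → ℂ} (h : IsCCWTriangle z) :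
    z 0 ≠ z 1 ∧ z 1 ≠ z 2 ∧ z 2 ≠ z 0 := by
  refine ⟨fun e => ?_, fun e => ?_, fun e => ?_⟩ <;>
  · simp only [IsCCWTriangle, e, sub_re, sub_im] at h
    linarith

/-- Membership in the family, in coordinates in which the circumcircle is the unit circle. -/
theorem scale_mem_brocardFamily_iff (h : IsBrocardScale a b l S C D R) {z : Fin 3 → ℂ}
    (hz : ∀ i, ‖z i‖ = 1) :
    (fun i => circleCenter a b l + R * z i) ∈ brocardFamily a b l ↔
      ∀ i, link S C D (z i) (z (i + 1)) = 0 := by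
  have hA := h.toIsBrocardAngle
  have hR := h.radius_pos
  have hins : IsInscribed (fun i => circleCenter a b l + R * z i) (circleCenter a b l)
      (circleRadius a b l) := by
    intro i
    simp [h.circleRadius_eq, hz, abs_of_pos hR]
  constructor
  · rintro ⟨hccw, -, hcirc⟩
    rw [isCCWTriangle_scale_iff _ hR] at hccw
    obtain ⟨n0, n1, n2⟩ := hccw.pairwise_ne
    have t0 := (tangent_iff_link h (hz 0) (hz 1) n0).1 (hcirc 0)
    have t1 := (tangent_iff_link h (hz 1) (hz 2) n1).1 (hcirc 1)
    have t2 := (tangent_iff_link h (hz 2) (hz 0) n2).1 (hcirc 2)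
    have key : link S C D (z 0) (z 1) = 0 ∧ link S C D (z 1) (z 2) = 0 ∧
        link S C D (z 2) (z 0) = 0 := by
      -- Mixed directions would link one vertex to, or from, both others, contradicting injectivity
      -- of the Möbius map.
      rcases t0 with t0 | t0
      · have u2 : link S C D (z 2) (z 0) = 0 :=
          t2.resolve_right fun t => n1 (link_right_injective hA (hz 0) t0 t)
        have u1 : link S C D (z 1) (z 2) = 0 :=
          t1.resolve_right fun t => n0 (link_right_injective hA (hz 2) u2 t)
        exact ⟨t0, u1, u2⟩
      -- All three links reversed make the triangle clockwise.
      · exfalso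
        have u2 : link S C D (z 0) (z 2) = 0 :=
          t2.resolve_left fun t => n1 (link_left_injective hA (hz 0) t0 t)
        have u1 : link S C D (z 2) (z 1) = 0 :=
          t1.resolve_left fun t => n0 (link_left_injective hA (hz 2) u2 t)
        have := area_pos_of_link hA (hz 1) (hz 0) (hz 2) t0 u2 u1
        simp only [IsCCWTriangle, sub_re, sub_im] at *
        linarith
    intro i
    fin_cases i
    exacts [key.1, key.2.1, key.2.2]
  · intro hl
    refine ⟨?_, hins, fun i => ?_⟩
    · rw [isCCWTriangle_scale_iff _ hR]
      exact area_pos_of_link hA (hz 0) (hz 1) (hz 2) (hl 0) (hl 1) (hl 2)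
    · exact (tangent_iff_link h (hz _) (hz _) (ne_of_link hA (hz i) (hl i))).2 (Or.inl (hl i))

/-- Points of the circumcircle in normalised coordinates. -/
theorem exists_scale_eq (h : IsBrocardScale a b l S C D R) {x : ℂ}
    (hx : x ∈ Metric.sphere (circleCenter a b l) (circleRadius a b l)) :
    ∃ z : ℂ, ‖z‖ = 1 ∧ x = circleCenter a b l + R * z := by
  have hR := h.radius_pos
  have hR' : (R : ℂ) ≠ 0 := by exact_mod_cast hR.ne'
  refine ⟨(x - circleCenter a b l) / R, ?_, ?_⟩
  · rw [norm_div, ← dist_eq, Metric.mem_sphere.1 hx, h.circleRadius_eq, norm_real,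
      Real.norm_of_nonneg hR.le, div_self hR.ne']
  · field_simp; ring

theorem exists_link_of_mem_brocardFamily (h : IsBrocardScale a b l S C D R) {P : Fin 3 → ℂ}
    (hP : P ∈ brocardFamily a b l) :
    ∃ z : Fin 3 → ℂ, (∀ i, ‖z i‖ = 1) ∧ (∀ i, P i = circleCenter a b l + R * z i) ∧
      ∀ i, link S C D (z i) (z (i + 1)) = 0 := by
  choose z hz e using fun i => exists_scale_eq h (hP.2.1 i)
  refine ⟨z, hz, e, (scale_mem_brocardFamily_iff h hz).1 ?_⟩
  rwa [← funext e]

/-! ### Brocard points of the families; the porism. -/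

theorem exists_angle {S C : ℝ} (hS : 0 < S) (h : S ^ 2 + C ^ 2 = 1) :
    ∃ ω : ℝ, 0 < ω ∧ ω < Real.pi ∧ Real.sin ω = S ∧ Real.cos ω = C := by
  have h1 : -1 ≤ C := by nlinarith
  have h2 : C ≤ 1 := by nlinarith
  have hsin : Real.sin (Real.arccos C) = S := by
    rw [Real.sin_arccos, show 1 - C ^ 2 = S ^ 2 by linarith, Real.sqrt_sq hS.le]
  have hpos : 0 < Real.sin (Real.arccos C) := by rwa [hsin]
  refine ⟨Real.arccos C, ?_, ?_, hsin, Real.cos_arccos h1 h2⟩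
  · refine lt_of_le_of_ne (Real.arccos_nonneg C) fun e => ?_
    rw [← e, Real.sin_zero] at hpos; exact lt_irrefl _ hpos
  · refine lt_of_le_of_ne (Real.arccos_le_pi C) fun e => ?_
    rw [e, Real.sin_pi] at hpos; exact lt_irrefl _ hpos

theorem isFirstBrocardPoint_iff (P : Fin 3 → ℂ) (Ω : ℂ) :
    IsFirstBrocardPoint P Ω ↔ ∃ S C : ℝ, 0 < S ∧ S ^ 2 + C ^ 2 = 1 ∧ ∀ i : Fin 3, ∃ t : ℝ, 0 < t ∧
      Ω - P i = t * ((C + S * I) * (P (i + 1) - P i)) := by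
  constructor
  · rintro ⟨ω, h0, hpi, h⟩
    refine ⟨Real.sin ω, Real.cos ω, Real.sin_pos_of_pos_of_lt_pi h0 hpi,
      Real.sin_sq_add_cos_sq ω, fun i => ?_⟩
    obtain ⟨t, ht, e⟩ := h i
    refine ⟨t, ht, ?_⟩
    rw [exp_mul_I] at e
    push_cast
    linear_combination e
  · rintro ⟨S, C, hS, hSC, h⟩
    obtain ⟨ω, h0, hpi, rfl, rfl⟩ := exists_angle hS hSC
    refine ⟨ω, h0, hpi, fun i => ?_⟩
    obtain ⟨t, ht, e⟩ := h i
    refine ⟨t, ht, ?_⟩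
    rw [exp_mul_I]
    push_cast at e
    linear_combination e

theorem isSecondBrocardPoint_iff (P : Fin 3 → ℂ) (Ω : ℂ) :
    IsSecondBrocardPoint P Ω ↔ ∃ S C : ℝ, 0 < S ∧ S ^ 2 + C ^ 2 = 1 ∧ ∀ i : Fin 3, ∃ t : ℝ, 0 < t ∧
      Ω - P i = t * ((C - S * I) * (P (i + 2) - P i)) := by
  have hexp (ω : ℝ) : exp (-(ω * I)) = (Real.cos ω : ℂ) - Real.sin ω * I := by
    rw [← neg_mul, exp_mul_I, Complex.cos_neg, Complex.sin_neg]; push_cast; ring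
  constructor
  · rintro ⟨ω, h0, hpi, h⟩
    refine ⟨Real.sin ω, Real.cos ω, Real.sin_pos_of_pos_of_lt_pi h0 hpi,
      Real.sin_sq_add_cos_sq ω, fun i => ?_⟩
    obtain ⟨t, ht, e⟩ := h i
    refine ⟨t, ht, ?_⟩
    rw [hexp] at e
    linear_combination e
  · rintro ⟨S, C, hS, hSC, h⟩
    obtain ⟨ω, h0, hpi, rfl, rfl⟩ := exists_angle hS hSC
    refine ⟨ω, h0, hpi, fun i => ?_⟩
    obtain ⟨t, ht, e⟩ := h i
    refine ⟨t, ht, ?_⟩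
    rw [hexp]
    linear_combination e

/-- The Brocard points of a linked triple, placed by the similarity `x ↦ O + k x`. -/
theorem isFirstBrocardPoint_of_link (h : IsBrocardAngle S C D) {z : Fin 3 → ℂ}
    (hz : ∀ i, ‖z i‖ = 1) (hl : ∀ i, link S C D (z i) (z (i + 1)) = 0) (O k : ℂ) :
    IsFirstBrocardPoint (fun i => O + k * z i) (O + k * (I * D * (C + S * I))) := by
  rw [isFirstBrocardPoint_iff]
  refine ⟨S, C, h.sin_pos, h.sq_add_sq, fun i => ?_⟩
  obtain ⟨t, ht, e⟩ := link_first h (hz i) (hl i)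
  exact ⟨t, ht, by linear_combination k * e⟩

theorem isSecondBrocardPoint_of_link (h : IsBrocardAngle S C D) {z : Fin 3 → ℂ}
    (hz : ∀ i, ‖z i‖ = 1) (hl : ∀ i, link S C D (z i) (z (i + 1)) = 0) (O k : ℂ) :
    IsSecondBrocardPoint (fun i => O + k * z i) (O + k * (I * D * (C - S * I))) := by
  rw [isSecondBrocardPoint_iff]
  refine ⟨S, C, h.sin_pos, h.sq_add_sq, fun i => ?_⟩
  have hi : i + 2 + 1 = i := by fin_cases i <;> rfl
  obtain ⟨t, ht, e⟩ := link_second h (z := z (i + 2)) (hz i) (by simpa only [hi] using hl (i + 2))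
  exact ⟨t, ht, by linear_combination k * e⟩

theorem brocardPoints_of_mem_brocardFamily (hb : 0 < b) (hab : b < a) (hl : l < b ^ 2)
    {P : Fin 3 → ℂ} (hP : P ∈ brocardFamily a b l) :
    IsFirstBrocardPoint P (-(focalDist a b : ℂ)) ∧ IsSecondBrocardPoint P (focalDist a b : ℂ) := by
  obtain ⟨S, C, D, R, h⟩ := exists_isBrocardScale hb hab hl
  obtain ⟨z, hz, e, hlink⟩ := exists_link_of_mem_brocardFamily h hP
  have h1 := isFirstBrocardPoint_of_link h.toIsBrocardAngle hz hlink (circleCenter a b l) R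
  have h2 := isSecondBrocardPoint_of_link h.toIsBrocardAngle hz hlink (circleCenter a b l) R
  rw [← funext e] at h1 h2
  rw [h.circleCenter_eq] at h1 h2
  rw [h.focalDist_eq]
  constructor
  · convert h1 using 1
    push_cast
    linear_combination (-R * S * D : ℂ) * I_sq
  · convert h2 using 1
    push_cast
    linear_combination (R * S * D : ℂ) * I_sq

theorem existsUnique_mem_brocardFamily (hb : 0 < b) (hab : b < a) (hl : l < b ^ 2) {x : ℂ}
    (hx : x ∈ Metric.sphere (circleCenter a b l) (circleRadius a b l)) :
    ∃! P : Fin 3 → ℂ, P ∈ brocardFamily a b l ∧ P 0 = x := by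
  obtain ⟨S, C, D, R, h⟩ := exists_isBrocardScale hb hab hl
  have hA := h.toIsBrocardAngle
  obtain ⟨z₀, hz₀, rfl⟩ := exists_scale_eq h hx
  obtain ⟨z₁, hz₁, h01⟩ := exists_link hA hz₀
  obtain ⟨z₂, hz₂, h12⟩ := exists_link hA hz₁
  have h20 := link_cycle hA hz₀ hz₁ h01 h12
  have hz : ∀ i, ‖(![z₀, z₁, z₂] : Fin 3 → ℂ) i‖ = 1 := by
    intro i; fin_cases i; exacts [hz₀, hz₁, hz₂]
  refine ⟨fun i => circleCenter a b l + R * (![z₀, z₁, z₂] : Fin 3 → ℂ) i, ⟨?_, rfl⟩, ?_⟩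
  · rw [scale_mem_brocardFamily_iff h hz]
    intro i; fin_cases i; exacts [h01, h12, h20]
  · rintro P ⟨hP, hP0⟩
    obtain ⟨y, hy, e, hlink⟩ := exists_link_of_mem_brocardFamily h hP
    have hR' : (R : ℂ) ≠ 0 := by exact_mod_cast h.radius_pos.ne'
    have e0 : y 0 = z₀ := by
      rw [e 0] at hP0
      exact mul_left_cancel₀ hR' (add_left_cancel hP0)
    have e1 : y 1 = z₁ := link_right_injective hA hz₀ (e0 ▸ hlink 0) h01
    have e2 : y 2 = z₂ := link_right_injective hA hz₁ (e1 ▸ hlink 1) h12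
    funext i
    rw [e i]
    fin_cases i
    · simp [e0]
    · simp [e1]
    · simp [e2]

end

/-! ### From a triangle with Brocard points back to a linked triple. -/

/-- Every nondegenerate triangle has a circumcircle. -/
theorem IsCCWTriangle.exists_circumcircle {P : Fin 3 → ℂ} (h : IsCCWTriangle P) :
    ∃ (O : ℂ) (R : ℝ) (z : Fin 3 → ℂ), 0 < R ∧ (∀ i, ‖z i‖ = 1) ∧ ∀ i, P i = O + R * z i := by
  obtain ⟨n0, -, -⟩ := h.pairwise_ne
  unfold IsCCWTriangle at h
  set u := P 1 - P 0 with hu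
  set v := P 2 - P 0 with hv
  set Δ := u.re * v.im - u.im * v.re with hΔ
  set o : ℂ := ⟨(normSq u * v.im - normSq v * u.im) / (2 * Δ),
    (u.re * normSq v - v.re * normSq u) / (2 * Δ)⟩ with ho
  have e1 : normSq (u - o) = normSq o := by
    simp only [ho, normSq_apply, sub_re, sub_im]
    field_simp
    rw [hΔ]
    ring
  have e2 : normSq (v - o) = normSq o := by
    simp only [ho, normSq_apply, sub_re, sub_im]
    field_simp
    rw [hΔ]
    ring
  have key : ∀ i, ‖P i - (P 0 + o)‖ = ‖o‖ := by
    have aux (x : ℂ) (e : normSq (x - o) = normSq o) : ‖x - o‖ = ‖o‖ := by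
      rw [normSq_eq_norm_sq, normSq_eq_norm_sq] at e
      exact (sq_eq_sq₀ (norm_nonneg _) (norm_nonneg _)).1 e
    intro i
    fin_cases i
    · simp
    · rw [← aux u e1, hu]; simp only [sub_sub, Fin.mk_one]
    · rw [← aux v e2, hv]; simp only [sub_sub, Fin.reduceFinMk]
  have hR : 0 < ‖o‖ := by
    refine norm_pos_iff.2 fun h0 => n0 ?_
    have k0 := key 1
    rw [h0, norm_zero, norm_eq_zero, add_zero, sub_eq_zero] at k0
    exact k0.symm
  have hR' : ((‖o‖ : ℝ) : ℂ) ≠ 0 := by exact_mod_cast hR.ne'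
  refine ⟨P 0 + o, ‖o‖, fun i => (P i - (P 0 + o)) / ‖o‖, hR, fun i => ?_, fun i => ?_⟩
  · rw [norm_div, key, norm_real, norm_norm, div_self hR.ne']
  · field_simp; ring

theorem ray_dot_cross {S C t : ℝ} {p z w : ℂ} (e : p - z = t * ((C + S * I) * (w - z))) :
    S * ((w - z).re * (p - z).re + (w - z).im * (p - z).im) =
      C * ((w - z).re * (p - z).im - (w - z).im * (p - z).re) := by
  rw [e]
  simp only [mul_re, mul_im, add_re, add_im, ofReal_re, ofReal_im, I_re, I_im]
  ring

/-- The cotangent of the Brocard angle is the sum of the squared sides over four times the area. -/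
theorem sin_mul_sides_eq_cos_mul_area {S C : ℝ} {x y v p : ℂ} {r s t : ℝ}
    (ex : p - x = r * ((C + S * I) * (y - x))) (ey : p - y = s * ((C + S * I) * (v - y)))
    (ev : p - v = t * ((C + S * I) * (x - v))) :
    S * (normSq (y - x) + normSq (v - y) + normSq (x - v)) =
      2 * C * ((y - x).re * (v - x).im - (y - x).im * (v - x).re) := by
  have h1 := ray_dot_cross ex
  have h2 := ray_dot_cross ey
  have h3 := ray_dot_cross ev
  simp only [normSq_apply, sub_re, sub_im] at *
  linear_combination 2 * h1 + 2 * h2 + 2 * h3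

/-- The cotangent formula determines the angle from the triangle; two rays at that angle from
different vertices are not parallel and meet only once. -/
theorem IsSecondBrocardPoint.unique {P : Fin 3 → ℂ} (h : IsCCWTriangle P) {Ω Ω' : ℂ}
    (h1 : IsSecondBrocardPoint P Ω) (h2 : IsSecondBrocardPoint P Ω') : Ω = Ω' := by
  rw [isSecondBrocardPoint_iff] at h1 h2
  obtain ⟨S, C, hS, hSC, h1⟩ := h1
  obtain ⟨S', C', hS', hSC', h2⟩ := h2
  have cot {S C : ℝ} {Ω : ℂ} (h : ∀ i : Fin 3, ∃ t : ℝ, 0 < t ∧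
      Ω - P i = t * ((C - S * I) * (P (i + 2) - P i))) :
      S * (normSq (P 2 - P 0) + normSq (P 1 - P 2) + normSq (P 0 - P 1)) =
      2 * C * ((P 1 - P 0).re * (P 2 - P 0).im - (P 1 - P 0).im * (P 2 - P 0).re) := by
    obtain ⟨r, -, er⟩ := h 0
    obtain ⟨s, -, es⟩ := h 1
    obtain ⟨t, -, et⟩ := h 2
    replace er : Ω - P 0 = r * ((C - S * I) * (P 2 - P 0)) := er
    replace es : Ω - P 1 = s * ((C - S * I) * (P 0 - P 1)) := es
    replace et : Ω - P 2 = t * ((C - S * I) * (P 1 - P 2)) := et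
    -- Traversing the triangle as 0, 2, 1 turns the clockwise rotation into one with sine `-S`.
    have := sin_mul_sides_eq_cos_mul_area (S := -S) (C := C) (x := P 0) (y := P 2) (v := P 1)
      (p := Ω) (r := r) (s := t) (t := s) (by push_cast; linear_combination er)
      (by push_cast; linear_combination et) (by push_cast; linear_combination es)
    linear_combination -this
  have k1 := cot h1
  have k2 := cot h2
  unfold IsCCWTriangle at h
  have hq : S * C' = S' * C := by
    have : 2 * (S * C' - S' * C) *
      ((P 1 - P 0).re * (P 2 - P 0).im - (P 1 - P 0).im * (P 2 - P 0).re) = 0 := by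
      linear_combination S' * k1 - S * k2
    have := (mul_eq_zero.1 this).resolve_right h.ne'
    linarith
  have hSS : S = S' := by
    have : S ^ 2 = S' ^ 2 := by
      linear_combination S' ^ 2 * hSC - S ^ 2 * hSC' + (S * C' + S' * C) * hq
    exact (sq_eq_sq₀ hS.le hS'.le).1 this
  subst hSS
  have hCC : C' = C := mul_left_cancel₀ hS.ne' hq
  subst hCC
  obtain ⟨r, -, er⟩ := h1 0
  obtain ⟨s, -, es⟩ := h1 1
  obtain ⟨r', -, er'⟩ := h2 0
  obtain ⟨s', -, es'⟩ := h2 1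
  have hne : (C' - S * I : ℂ) ≠ 0 := by
    intro h0
    have := congrArg im h0
    simp at this
    exact hS.ne' this
  have e : ((r - r' : ℝ) : ℂ) * (P 2 - P 0) = ((s - s' : ℝ) : ℂ) * (P 0 - P 1) := by
    apply mul_left_cancel₀ hne
    push_cast
    simp only [Fin.isValue, zero_add, show (1 + 2 : Fin 3) = 0 from rfl] at *
    linear_combination es - es' - er + er'
  have hr : r - r' = 0 := by
    have e1 := congrArg re e
    have e2 := congrArg im e
    simp only [mul_re, mul_im, ofReal_re, ofReal_im, sub_re, sub_im] at e1 e2 h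
    have : (r - r') * (((P 1).re - (P 0).re) * ((P 2).im - (P 0).im) -
        ((P 1).im - (P 0).im) * ((P 2).re - (P 0).re)) = 0 := by
      linear_combination ((P 1).re - (P 0).re) * e2 - ((P 1).im - (P 0).im) * e1
    exact (mul_eq_zero.1 this).resolve_right h.ne'
  have : r = r' := by linarith
  subst this
  linear_combination er - er'

/-- Elimination of the ray parameter on the unit circle. -/
theorem bilinear_of_ray {S C t : ℝ} {p z w : ℂ} (hz : ‖z‖ = 1)
    (hw : ‖w‖ = 1) (e : p - z = t * ((C + S * I) * (w - z))) :
    (C + S * I) * w + (C - S * I) * z - (C + S * I) * conj p * (z * w) - (C - S * I) * p = 0 := by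
  have hzz := mul_conj_of_norm_eq_one hz
  have hww := mul_conj_of_norm_eq_one hw
  have e' := congrArg conj e
  simp only [map_sub, map_mul, map_add, conj_ofReal, conj_I] at e'
  have e2 : conj p * (z * w) - w = t * ((C - S * I) * (z - w)) := by
    -- The conjugate ray equation times `z w`, with `conj z = 1 / z`; together with the original it
    -- allows `t` to be eliminated.
    linear_combination z * w * e' + (w - t * (C - S * I) * w) * hzz + (t * (C - S * I) * z) * hww
  linear_combination -(C - S * I) * e - (C + S * I) * e2

/-- A Möbius transformation with a cycle of length three satisfies `(tr M)² = det M`. -/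
theorem mobius_three_cycle {e e' g g' z₀ z₁ z₂ : ℂ}
    (h0 : e * z₁ + e' * z₀ - g' * (z₀ * z₁) - g = 0)
    (h1 : e * z₂ + e' * z₁ - g' * (z₁ * z₂) - g = 0)
    (h2 : e * z₀ + e' * z₂ - g' * (z₂ * z₀) - g = 0)
    (hne : e - g' * z₀ ≠ 0) (hz : z₁ ≠ z₀) :
    (e - e') ^ 2 = g * g' - e * e' := by
  have hfix : (e + e') * z₀ - g' * z₀ ^ 2 - g ≠ 0 := by
    intro h
    have : (z₁ - z₀) * (e - g' * z₀) = 0 := by linear_combination h0 - h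
    rcases mul_eq_zero.1 this with h | h
    exacts [hz (sub_eq_zero.1 h), hne h]
  -- By Cayley–Hamilton, `M³ = (tr² - det) M - (tr · det)`; so if `M³` fixes `z₀`, then `tr² - det`
  -- times the fixed-point form at `z₀` vanishes.
  apply sub_eq_zero.1
  apply (mul_eq_zero.1 _).resolve_right hfix
  have e1 : z₁ * (e - g' * z₀) = g - e' * z₀ := by linear_combination h0
  have e2 : z₂ * (e * (e - g' * z₀) - g' * (g - e' * z₀)) =
      g * (e - g' * z₀) - e' * (g - e' * z₀) := by
    linear_combination (e - g' * z₀) * h1 + (g' * z₂ - e') * e1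
  have e3 : z₂ * (e' - g' * z₀) = g - e * z₀ := by linear_combination h2
  linear_combination (e * (e - g' * z₀) - g' * (g - e' * z₀)) * e3 - (e' - g' * z₀) * e2

/-- A triangle with a first Brocard point is, up to a similarity, a linked triple. -/
theorem IsCCWTriangle.exists_link {P : Fin 3 → ℂ} {Ω : ℂ} (h : IsCCWTriangle P)
    (h1 : IsFirstBrocardPoint P Ω) :
    ∃ (S C D : ℝ) (O v : ℂ) (R : ℝ) (z : Fin 3 → ℂ), IsBrocardAngle S C D ∧ 0 < R ∧ ‖v‖ = 1 ∧
      (∀ i, ‖z i‖ = 1) ∧ (∀ i, link S C D (z i) (z (i + 1)) = 0) ∧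
      (∀ i, P i = O + R * v * z i) ∧ Ω = O + R * v * (I * D * (C + S * I)) := by
  obtain ⟨O, R, z, hR, hz, hP⟩ := h.exists_circumcircle
  rw [isFirstBrocardPoint_iff] at h1
  obtain ⟨S, C, hS, hSC, h1⟩ := h1
  have hne := h.pairwise_ne
  have hR' : (R : ℂ) ≠ 0 := by exact_mod_cast hR.ne'
  -- Squared sides and area are both positive, so the cotangent formula makes the Brocard angle
  -- acute.
  have hC : 0 < C := by
    obtain ⟨r, -, er⟩ := h1 0
    obtain ⟨s, -, es⟩ := h1 1
    obtain ⟨t, -, et⟩ := h1 2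
    have := sin_mul_sides_eq_cos_mul_area er es et
    have h3 : 0 < normSq (P 1 - P 0) := normSq_pos.2 (sub_ne_zero.2 hne.1.symm)
    have h4 := normSq_nonneg (P 2 - P 1)
    have h5 := normSq_nonneg (P 0 - P 2)
    have h6 : 0 < S * (normSq (P 1 - P 0) + normSq (P 2 - P 1) + normSq (P 0 - P 2)) := by
      positivity
    have h7 : 0 < 2 * C * ((P 1 - P 0).re * (P 2 - P 0).im - (P 1 - P 0).im * (P 2 - P 0).re) :=
      h6.trans_eq this
    have := pos_of_mul_pos_left h7 h.le
    linarith
  obtain ⟨p, hp⟩ : ∃ p, Ω = O + R * p := ⟨(Ω - O) / R, by field_simp; ring⟩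
  have hray : ∀ i, ∃ t : ℝ, 0 < t ∧ p - z i = t * ((C + S * I) * (z (i + 1) - z i)) := by
    intro i
    obtain ⟨t, ht, e⟩ := h1 i
    refine ⟨t, ht, mul_left_cancel₀ hR' ?_⟩
    rw [hP i, hP (i + 1), hp] at e
    linear_combination e
  have hrot : ((C : ℂ) + S * I) * (C - S * I) = 1 := by
    have : ((S : ℂ) ^ 2 + C ^ 2) = 1 := by exact_mod_cast hSC
    linear_combination this - (S : ℂ) ^ 2 * I_sq
  have hbil (i : Fin 3) : (C + S * I) * z (i + 1) + (C - S * I) * z i -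
      (C + S * I) * conj p * (z i * z (i + 1)) - (C - S * I) * p = 0 := by
    obtain ⟨t, -, e⟩ := hray i
    exact bilinear_of_ray (hz i) (hz (i + 1)) e
  have hz01 : z 1 ≠ z 0 := fun e => hne.1 (by rw [hP 0, hP 1, e])
  have hrot0 : (C : ℂ) + S * I ≠ 0 := left_ne_zero_of_mul_eq_one hrot
  -- At the pole, `p` would equal `z 0`, which a ray with positive parameter excludes.
  have hden : (C + S * I) - (C + S * I) * conj p * z 0 ≠ 0 := by
    intro h0
    have h2 : conj p * z 0 = 1 := by
      apply mul_left_cancel₀ hrot0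
      linear_combination -h0
    have h3 : p = z 0 := by
      have := congrArg conj h2
      simp only [map_mul, conj_conj, map_one] at this
      linear_combination z 0 * this - p * mul_conj_of_norm_eq_one (hz 0)
    obtain ⟨t, ht, e⟩ := hray 0
    rw [h3, sub_self, eq_comm, mul_eq_zero, mul_eq_zero, ofReal_eq_zero, sub_eq_zero] at e
    rcases e with e | e | e
    exacts [ht.ne' e, hrot0 e, hz01 e]
  have htr := mobius_three_cycle (hbil 0) (hbil 1) (hbil 2) hden hz01
  have hpn : ‖p‖ ^ 2 = 1 - 4 * S ^ 2 := by
    have h2 : p * conj p = ((‖p‖ ^ 2 : ℝ) : ℂ) := by rw [mul_conj, normSq_eq_norm_sq]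
    have h3 : ((‖p‖ ^ 2 : ℝ) : ℂ) = ((1 - 4 * S ^ 2 : ℝ) : ℂ) := by
      rw [← h2]
      push_cast
      linear_combination -htr + (1 - p * conj p) * hrot + 4 * (S : ℂ) ^ 2 * I_sq
    exact_mod_cast h3
  have hA : IsBrocardAngle S C ‖p‖ := ⟨hS, hC, norm_nonneg _, hSC, hpn⟩
  -- `v` is the rotation taking `I * D * (C + S * I)` to `p`; it is arbitrary when `p` is the
  -- circumcentre.
  obtain ⟨v, hv, hgv⟩ : ∃ v : ℂ, ‖v‖ = 1 ∧ (C - S * I) * p = I * ‖p‖ * v := by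
    by_cases h0 : p = 0
    · exact ⟨1, norm_one, by simp [h0]⟩
    · have h2 : ((‖p‖ : ℝ) : ℂ) ≠ 0 := by exact_mod_cast norm_ne_zero_iff.2 h0
      refine ⟨(C - S * I) * p / (I * ‖p‖), ?_, ?_⟩
      · rw [norm_div, norm_mul, norm_mul, hA.norm_rot_neg, norm_I, norm_real, norm_norm, one_mul,
          div_self (norm_ne_zero_iff.2 h0)]
      · field_simp
  have hvv := mul_conj_of_norm_eq_one hv
  have hgv' : (C + S * I) * conj p = -(I * ‖p‖ * conj v) := by
    have := congrArg conj hgv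
    simp only [map_mul, map_sub, conj_ofReal, conj_I] at this
    linear_combination this
  refine ⟨S, C, ‖p‖, O, v, R, fun i => conj v * z i, hA, hR, hv, fun i => ?_, fun i => ?_,
    fun i => ?_, ?_⟩
  · rw [norm_mul, norm_conj, hv, hz, one_mul]
  · have := hbil i
    rw [hgv, hgv'] at this
    simp only [link]
    linear_combination conj v * this + I * ‖p‖ * hvv
  · rw [hP i]; linear_combination -(R : ℂ) * z i * hvv
  · rw [hp]
    linear_combination (-(R : ℂ) * p) * hrot + R * (C + S * I) * hgv

/-! ### Covering by the families, and uniqueness of the parameter. -/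

section
variable {a b : ℝ}

theorem exists_mem_brocardFamily (hb : 0 < b) (hab : b < a) {P : Fin 3 → ℂ}
    (h : IsCCWTriangle P) (h1 : IsFirstBrocardPoint P (-(focalDist a b : ℂ)))
    (h2 : IsSecondBrocardPoint P (focalDist a b : ℂ)) :
    ∃ l < b ^ 2, P ∈ brocardFamily a b l := by
  have hab2 : 0 < a ^ 2 - b ^ 2 := by nlinarith
  have hc : 0 < focalDist a b := Real.sqrt_pos.2 hab2
  have hc2 : focalDist a b ^ 2 = a ^ 2 - b ^ 2 := Real.sq_sqrt hab2.le
  obtain ⟨S, C, D, O, v, R, z, hA, hR, hv, hz, hl, hP, hΩ⟩ := h.exists_link h1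
  have hS := hA.sin_pos
  have h2' := isSecondBrocardPoint_of_link hA hz hl O (R * v)
  rw [← funext hP] at h2'
  have hΩ' := IsSecondBrocardPoint.unique h h2 h2'
  generalize focalDist a b = c at *
  -- Half the difference of the Brocard points; its modulus gives `c`, and then `v = 1`. Their
  -- midpoint gives `O` below.
  have hcv : (c : ℂ) = R * S * D * v := by
    linear_combination (1 / 2 : ℂ) * hΩ' - (1 / 2 : ℂ) * hΩ - (R * S * D * v : ℂ) * I_sq
  have hcR : c = R * S * D := by
    have := congrArg norm hcv
    simpa [hv, abs_of_pos hc, abs_of_pos hR, abs_of_pos hS, abs_of_nonneg hA.nonneg] using this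
  have hc0 : (c : ℂ) ≠ 0 := by exact_mod_cast hc.ne'
  have hv1 : v = 1 := by
    apply mul_left_cancel₀ hc0
    have : (c : ℂ) = R * S * D := by exact_mod_cast hcR
    rw [mul_one]
    nth_rw 1 [this]
    exact hcv.symm
  subst hv1
  have hD : 0 < D := by
    refine lt_of_le_of_ne hA.nonneg fun h0 => hc.ne' ?_
    rw [hcR, ← h0, mul_zero]
  -- The parameter is forced by the minor semiaxis `2 R S²`.
  have hscale : IsBrocardScale a b (b ^ 2 - 4 * R ^ 2 * S ^ 4) S C D R := by
    refine ⟨hA, hD, hR, ?_, by ring⟩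
    rw [hcR] at hc2
    linear_combination -hc2 + R ^ 2 * S ^ 2 * hA.sq_eq
  have hpos : 0 < 4 * R ^ 2 * S ^ 4 := by positivity
  refine ⟨b ^ 2 - 4 * R ^ 2 * S ^ 4, by linarith, ?_⟩
  have hO : O = circleCenter a b (b ^ 2 - 4 * R ^ 2 * S ^ 4) := by
    rw [hscale.circleCenter_eq]
    push_cast
    linear_combination (-1 / 2 : ℂ) * hΩ' - (1 / 2 : ℂ) * hΩ
  have hP' : P = fun i => circleCenter a b (b ^ 2 - 4 * R ^ 2 * S ^ 4) + R * z i := by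
    funext i
    rw [hP i, ← hO, mul_one]
  rw [hP']
  exact (scale_mem_brocardFamily_iff hscale hz).2 hl

/-- The circumcentre determines the parameter of the family. -/
theorem brocardFamily_disjoint (hb : 0 < b) (hab : b < a) {l l' : ℝ} (hl : l < b ^ 2)
    (hl' : l' < b ^ 2) {P : Fin 3 → ℂ} (hP : P ∈ brocardFamily a b l)
    (hP' : P ∈ brocardFamily a b l') : l = l' := by
  have hc : 0 < focalDist a b := Real.sqrt_pos.2 (by nlinarith)
  have hsphere (m : ℝ) (hm : P ∈ brocardFamily a b m) (i : Fin 3) :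
      (P i).re ^ 2 + ((P i).im - (circleCenter a b m).im) ^ 2 = circleRadius a b m ^ 2 := by
    have := hm.2.1 i
    rw [Metric.mem_sphere, dist_eq] at this
    rw [← this, Complex.sq_norm, normSq_apply]
    simp [circleCenter]
    ring
  -- Both centres lie on the imaginary axis; if they differed, subtracting the circle equations
  -- would put all vertices on one horizontal line.
  have him : (circleCenter a b l).im = (circleCenter a b l').im := by
    by_contra hne
    have hd : (circleCenter a b l).im - (circleCenter a b l').im ≠ 0 := sub_ne_zero.2 hne
    have h0 := hsphere l hP 0
    have h1 := hsphere l hP 1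
    have h2 := hsphere l hP 2
    have h0' := hsphere l' hP' 0
    have h1' := hsphere l' hP' 1
    have h2' := hsphere l' hP' 2
    have e1 : (P 1).im = (P 0).im := by
      apply mul_left_cancel₀ hd
      linear_combination (-h1 + h1' + h0 - h0') / 2
    have e2 : (P 2).im = (P 0).im := by
      apply mul_left_cancel₀ hd
      linear_combination (-h2 + h2' + h0 - h0') / 2
    have := hP.1
    simp only [IsCCWTriangle, sub_re, sub_im, e1, e2] at this
    linarith
  have ha : b ^ 2 < a ^ 2 := by nlinarith
  have hsq (m : ℝ) (hm : m < b ^ 2) : (circleCenter a b m).im ^ 2 * (b ^ 2 - m) =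
      focalDist a b ^ 2 * (4 * a ^ 2 - b ^ 2 - 3 * m) := by
    have h0 : 0 < b ^ 2 - m := by linarith
    simp only [circleCenter]
    rw [neg_sq, div_pow, mul_pow, Real.sq_sqrt h0.le, Real.sq_sqrt (by linarith)]
    field_simp
  have e1 := hsq l hl
  have e2 := hsq l' hl'
  rw [him] at e1
  -- As `4a² - b² - 3l = 3(b² - l) + 4(a² - b²)`, the squared height of the centre is injective in
  -- `l`.
  have e3 : focalDist a b ^ 2 * (4 * (a ^ 2 - b ^ 2)) * (l - l') = 0 := by
    linear_combination (b ^ 2 - l) * e2 - (b ^ 2 - l') * e1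
  have e4 : focalDist a b ^ 2 * (4 * (a ^ 2 - b ^ 2)) ≠ 0 := by
    have : 0 < a ^ 2 - b ^ 2 := by linarith
    positivity
  exact sub_eq_zero.1 ((mul_eq_zero.1 e3).resolve_left e4)

/-! ### Interchanging the Brocard points by the half-turn about the origin, which keeps orientation
and ellipses, swaps the foci and reflects the circle. -/

theorem isCCWTriangle_neg_iff (P : Fin 3 → ℂ) : IsCCWTriangle (-P) ↔ IsCCWTriangle P := by
  simp only [IsCCWTriangle, Pi.neg_apply, sub_re, sub_im, neg_re, neg_im]
  ring_nf

theorem isFirstBrocardPoint_neg_iff (P : Fin 3 → ℂ) (Ω : ℂ) :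
    IsFirstBrocardPoint (-P) (-Ω) ↔ IsFirstBrocardPoint P Ω := by
  simp only [IsFirstBrocardPoint, Pi.neg_apply]
  refine exists_congr fun ω => and_congr_right' <| and_congr_right' <| forall_congr' fun i =>
    exists_congr fun t => and_congr_right' ?_
  rw [← neg_inj]
  ring_nf

theorem isSecondBrocardPoint_neg_iff (P : Fin 3 → ℂ) (Ω : ℂ) :
    IsSecondBrocardPoint (-P) (-Ω) ↔ IsSecondBrocardPoint P Ω := by
  simp only [IsSecondBrocardPoint, Pi.neg_apply]
  refine exists_congr fun ω => and_congr_right' <| and_congr_right' <| forall_congr' fun i =>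
    exists_congr fun t => and_congr_right' ?_
  rw [← neg_inj]
  ring_nf

theorem neg_mem_confocalEllipse_iff {l : ℝ} (x : ℂ) :
    -x ∈ confocalEllipse a b l ↔ x ∈ confocalEllipse a b l := by
  simp [confocalEllipse]

theorem Circumscribes.neg {P : Fin 3 → ℂ} {l : ℝ} (h : Circumscribes P (confocalEllipse a b l)) :
    Circumscribes (-P) (confocalEllipse a b l) := by
  intro i
  obtain ⟨T, hT, e⟩ := h i
  have hline (x : ℂ) : x ∈ line[ℝ, (-P) i, (-P) (i + 1)] ↔ -x ∈ line[ℝ, P i, P (i + 1)] := by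
    simp only [mem_affineSpan_pair_iff_exists_lineMap_eq, Pi.neg_apply]
    refine exists_congr fun r => ?_
    rw [← neg_inj (b := x)]
    simp only [AffineMap.lineMap_apply, vsub_eq_sub, vadd_eq_add, real_smul]
    ring_nf
  refine ⟨-T, ?_, ?_⟩
  · obtain ⟨s, t, hs, ht, hst, rfl⟩ := hT
    exact ⟨s, t, hs, ht, hst, by simp [add_comm]⟩
  · ext x
    have := Set.ext_iff.1 e (-x)
    simp only [Set.mem_inter_iff, SetLike.mem_coe, Set.mem_singleton_iff,
      neg_mem_confocalEllipse_iff] at this ⊢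
    rw [hline, this, neg_eq_iff_eq_neg]

theorem circumscribes_neg_iff {P : Fin 3 → ℂ} {l : ℝ} :
    Circumscribes (-P) (confocalEllipse a b l) ↔ Circumscribes P (confocalEllipse a b l) :=
  ⟨fun h => by simpa using h.neg, fun h => h.neg⟩

theorem neg_mem_brocardFamily_iff {P : Fin 3 → ℂ} {l : ℝ} :
    -P ∈ brocardFamily a b l ↔ P ∈ reflectedBrocardFamily a b l := by
  have hO : starRingEnd ℂ (circleCenter a b l) = -circleCenter a b l := by
    apply Complex.ext <;> simp [circleCenter]
  refine and_congr (isCCWTriangle_neg_iff P) (and_congr ?_ circumscribes_neg_iff)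
  refine forall_congr' fun i => ?_
  rw [hO, Metric.mem_sphere, Metric.mem_sphere, Pi.neg_apply, dist_eq, dist_eq, ← norm_neg]
  ring_nf

/-! ### The focal description of the ellipses. -/

theorem confocalEllipse_eq_focal (hb : 0 < b) (hab : b < a) {l : ℝ} (hl : l < b ^ 2) :
    confocalEllipse a b l =
      {z : ℂ | dist z (-(focalDist a b : ℂ)) + dist z (focalDist a b : ℂ) = 2 * √(a ^ 2 - l)} := by
  have hab2 : 0 < a ^ 2 - b ^ 2 := by nlinarith
  have hc2 : focalDist a b ^ 2 = a ^ 2 - b ^ 2 := Real.sq_sqrt hab2.le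
  have hc : 0 < focalDist a b := Real.sqrt_pos.2 hab2
  have hA : 0 < a ^ 2 - l := by linarith
  have hB : 0 < b ^ 2 - l := by linarith
  have hα : 0 < √(a ^ 2 - l) := Real.sqrt_pos.2 hA
  have hα2 : √(a ^ 2 - l) ^ 2 = a ^ 2 - l := Real.sq_sqrt hA.le
  ext z
  have d1 : dist z (-(focalDist a b : ℂ)) ^ 2 = (z.re + focalDist a b) ^ 2 + z.im ^ 2 := by
    rw [dist_eq, Complex.sq_norm, normSq_apply]; simp; ring
  have d2 : dist z (focalDist a b : ℂ) ^ 2 = (z.re - focalDist a b) ^ 2 + z.im ^ 2 := by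
    rw [dist_eq, Complex.sq_norm, normSq_apply]; simp; ring
  have p1 : 0 ≤ dist z (-(focalDist a b : ℂ)) := dist_nonneg
  have p2 : 0 ≤ dist z (focalDist a b : ℂ) := dist_nonneg
  simp only [confocalEllipse, Set.mem_ofPred_eq]
  rw [div_add_div _ _ hA.ne' hB.ne', div_eq_one_iff_eq (by positivity)]
  generalize dist z (-(focalDist a b : ℂ)) = r at *
  generalize dist z (focalDist a b : ℂ) = s at *
  generalize focalDist a b = c at *
  generalize √(a ^ 2 - l) = α at *
  generalize z.re = x at *
  generalize z.im = y at *
  have hAB : a ^ 2 - l = b ^ 2 - l + c ^ 2 := by linarith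
  rw [hAB] at hA hα2 ⊢
  generalize b ^ 2 - l = B at *
  constructor
  · intro e
    have hx : x ^ 2 ≤ α ^ 2 := by
      rw [hα2]
      refine le_of_mul_le_mul_right ?_ hB
      nlinarith [mul_nonneg hA.le (sq_nonneg y)]
    have hcα : c ^ 2 < α ^ 2 := by linarith
    have hcα' : c < α := lt_of_pow_lt_pow_left₀ 2 hα.le hcα
    have hx' := abs_le_of_sq_le_sq' hx hα.le
    -- Focal radii: `r = α + c x / α` and `s = α - c x / α`. The bounds `|x| ≤ α` and `c < α` make
    -- both sides nonnegative, so it suffices to compare squares.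
    have k1 : α * r = α ^ 2 + c * x := by
      refine (sq_eq_sq₀ (by positivity) (by nlinarith)).1 ?_
      rw [mul_pow, d1, hα2]
      linear_combination e
    have k2 : α * s = α ^ 2 - c * x := by
      refine (sq_eq_sq₀ (by positivity) (by nlinarith)).1 ?_
      rw [mul_pow, d2, hα2]
      linear_combination e
    apply mul_left_cancel₀ hα.ne'
    linear_combination k1 + k2
  · intro e
    -- Dividing `r² - s² = 4 c x` by `r + s = 2 α` gives `r - s`, hence `r`.
    have k1 : α * r = α ^ 2 + c * x := by
      linear_combination (d1 - d2) / 4 + (α / 2 - (r - s) / 4) * e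
    have k2 := congrArg (· ^ 2) k1
    simp only [mul_pow, d1] at k2
    rw [hα2] at k2
    linear_combination k2

end
end BrocardPorism

open BrocardPorism in
theorem mainTheorem4 (a b : ℝ) (hb : 0 < b) (hab : b < a) :
    -- the points `(± c, 0)` are the foci of every ellipse of the family
    (∀ l < b ^ 2, confocalEllipse a b l =
      {z : ℂ | dist z (-(focalDist a b : ℂ)) + dist z (focalDist a b : ℂ) = 2 * √(a ^ 2 - l)}) ∧
    -- the triangles of each family have their Brocard points at the foci
    (∀ l < b ^ 2, ∀ P ∈ brocardFamily a b l,
      IsFirstBrocardPoint P (-(focalDist a b : ℂ)) ∧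
        IsSecondBrocardPoint P (focalDist a b : ℂ)) ∧
    -- each family is a one-parameter family: each point of the circle is the
    -- first vertex of exactly one of its triangles
    (∀ l < b ^ 2, ∀ z ∈ Metric.sphere (circleCenter a b l) (circleRadius a b l),
      ∃! P : Fin 3 → ℂ, P ∈ brocardFamily a b l ∧ P 0 = z) ∧
    -- the families cover all triangles with these Brocard points, each exactly once
    (∀ P : Fin 3 → ℂ, IsCCWTriangle P →
      IsFirstBrocardPoint P (-(focalDist a b : ℂ)) →
      IsSecondBrocardPoint P (focalDist a b : ℂ) →
      ∃! l : ℝ, l < b ^ 2 ∧ P ∈ brocardFamily a b l) ∧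
    -- with the two Brocard points interchanged one gets exactly the reflected families
    (∀ P : Fin 3 → ℂ, IsCCWTriangle P →
      ((IsFirstBrocardPoint P (focalDist a b : ℂ) ∧
        IsSecondBrocardPoint P (-(focalDist a b : ℂ))) ↔
      ∃ l : ℝ, l < b ^ 2 ∧ P ∈ reflectedBrocardFamily a b l)) := by
  refine ⟨fun l hl => confocalEllipse_eq_focal hb hab hl,
    fun l hl P hP => brocardPoints_of_mem_brocardFamily hb hab hl hP,
    fun l hl z hz => existsUnique_mem_brocardFamily hb hab hl hz, fun P hP h1 h2 => ?_,
    fun P hP => ?_⟩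
  · obtain ⟨l, hl, hPl⟩ := exists_mem_brocardFamily hb hab hP h1 h2
    exact ⟨l, ⟨hl, hPl⟩, fun l' h' => brocardFamily_disjoint hb hab h'.1 hl h'.2 hPl⟩
  · rw [← isFirstBrocardPoint_neg_iff, ← isSecondBrocardPoint_neg_iff, neg_neg]
    constructor
    · rintro ⟨h1, h2⟩
      obtain ⟨l, hl, hPl⟩ :=
        exists_mem_brocardFamily hb hab ((isCCWTriangle_neg_iff P).2 hP) h1 h2
      exact ⟨l, hl, neg_mem_brocardFamily_iff.1 hPl⟩
    · rintro ⟨l, hl, hPl⟩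
      exact brocardPoints_of_mem_brocardFamily hb hab hl (neg_mem_brocardFamily_iff.2 hPl)
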